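/- Let $(W,S)$ be a finite Coxeter system with length function $\ell$, let $m(s,t)$ denote the order of $st$, and let $\mathbb{K}$ be a field. The $0$-Hecke algebra $H_W(0)$ is the associative unital $\mathbb{K}$-algebra generated by $\{\pi_s : s\in S\}$ subject to $\pi_s^2=\pi_s$ and, for distinct $s,t\in S$, $\pi_s\pi_t\pi_s\cdots=\pi_t\pi_s\pi_t\cdots$ with $m(s,t)$ factors on each side. Let $\le_L$ be the left weak Bruhat order on $W$: $u\le_L v$ if $v=s_1\cdots s_k u$ for some $s_1,\dots,s_k\in S$ with $\ell(v)=\ell(u)+k$; write $[u,v]_L=\{w\in W: u\le_L w\le_L v\}$. The weak Bruhat interval module $\mathrm{B}(u,v)$ is the left $H_W(0)$-module with $\mathbb{K}$-basis $[u,v]_L$ and action $$\pi_s w=\begin{cases} w & \text{if } \ell(sw)<\ell(w),\\ sw & \text{if } \ell(sw)>\ell(w) \text{ and } sw\in[u,v]_L,\\ 0 & \text{if } \ell(sw)>\ell(w)\text{ and } sw\notin[u,v]_L.\end{cases}$$ For $I\subseteq S$ let $\mathcal{D}_I=\{w\in W : \{s\in S:\ell(ws)<\ell(w)\}=I\}$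 be the right descent class of $I$, let $u_I$ and $v_I$ be its shortest and longest elements, and let $\mathrm{P}_I=\mathrm{B}(u_I,v_I)$ (these modules are, up to isomorphism, the projective indecomposable $H_W(0)$-modules). A module is called indecomposable if it is nonzero and is not the direct sum of two nonzero submodules. **Proposition.** Let $I\subseteq S$. The module $\mathrm{P}_I$, every nonzero submodule of $\mathrm{P}_I$, and every nonzero quotient of $\mathrm{P}_I$ are indecomposable. Moreover, for every $w\in\mathcal{D}_I$, the modules $\mathrm{B}(w,v_I)$ and $\mathrm{B}(u_I,w)$ are indecomposable, and every nonzero submodule of $\mathrm{B}(w,v_I)$ and every nonzero quotient of $\mathrm{B}(u_I,w)$ is indecomposable. -/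

import Mathlib

/-! ### The 0-Hecke algebra -/

/-- The defining relations of the `0`-Hecke algebra: `π_i ^ 2 = π_i`, and the two alternating
products of `π_i` and `π_j` with `M i j` factors agree.  (An entry `M i j = 0` of a Coxeter matrix
means that there is no relation, and then both products are empty.) -/
inductive ZeroHeckeRel {B : Type*} (K : Type*) [Field K] (M : CoxeterMatrix B) :
    FreeAlgebra K B → FreeAlgebra K B → Prop
  | idem (i : B) : ZeroHeckeRel K M (FreeAlgebra.ι K i * FreeAlgebra.ι K i) (FreeAlgebra.ι K i)
  | braid (i j : B) (hij : i ≠ j) : ZeroHeckeRel K M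
      ((CoxeterSystem.alternatingWord i j (M i j)).map (FreeAlgebra.ι K)).prod
      ((CoxeterSystem.alternatingWord j i (M i j)).map (FreeAlgebra.ι K)).prod

/-- The `0`-Hecke algebra `H_W(0)` over the field `K` of a Coxeter system with Coxeter
matrix `M`. -/
def ZeroHecke {B : Type*} (K : Type*) [Field K] (M : CoxeterMatrix B) : Type _ :=
  RingQuot (ZeroHeckeRel K M)

namespace ZeroHecke

variable {B : Type*} (K : Type*) [Field K] (M : CoxeterMatrix B)

noncomputable instance instRing : Ring (ZeroHecke K M) :=
  inferInstanceAs (Ring (RingQuot (ZeroHeckeRel K M)))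

noncomputable instance instAlgebra : Algebra K (ZeroHecke K M) :=
  inferInstanceAs (Algebra K (RingQuot (ZeroHeckeRel K M)))

/-- The generator `π_i` of `H_W(0)`. -/
noncomputable def gen (i : B) : ZeroHecke K M :=
  RingQuot.mkAlgHom K (ZeroHeckeRel K M) (FreeAlgebra.ι K i)

end ZeroHecke

/-! ### Combinatorics of Coxeter systems -/

namespace CoxeterSystem

variable {B W : Type*} [Group W] {M : CoxeterMatrix B} (cs : CoxeterSystem M W)

/-- The left weak Bruhat order: `v = s_1 ⋯ s_k u` with `ℓ v = ℓ u + k`. -/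
def LeftWeakLE (u v : W) : Prop :=
  ∃ ω : List B, v = cs.wordProd ω * u ∧ cs.length v = cs.length u + ω.length

/-- The left weak Bruhat interval `[u, v]_L`. -/
def leftInterval (u v : W) : Set W := {w | cs.LeftWeakLE u w ∧ cs.LeftWeakLE w v}

/-- The right descent class of `I`: all elements whose set of right descents is `I`. -/
def descentClass (I : Set B) : Set W := {w | {i | cs.IsRightDescent w i} = I}

open scoped Classical in
/-- The element `u_I`: the shortest element of the right descent class of `I`.
(The value `1` outside the first case is never used: right descent classes of a finite Coxeter
group are nonempty.) -/
noncomputable def shortest (I : Set B) : W :=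
  if h : ∃ u ∈ cs.descentClass I, ∀ w ∈ cs.descentClass I, cs.length u ≤ cs.length w
  then h.choose else 1

open scoped Classical in
/-- The element `v_I`: the longest element of the right descent class of `I`. -/
noncomputable def longest (I : Set B) : W :=
  if h : ∃ v ∈ cs.descentClass I, ∀ w ∈ cs.descentClass I, cs.length w ≤ cs.length v
  then h.choose else 1

theorem LeftWeakLE.trans {cs : CoxeterSystem M W} {u v w : W} (h : cs.LeftWeakLE u v)
    (h' : cs.LeftWeakLE v w) : cs.LeftWeakLE u w := by
  obtain ⟨a, rfl, ha⟩ := h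
  obtain ⟨b, rfl, hb⟩ := h'
  exact ⟨b ++ a, by simp [wordProd_append, mul_assoc], by simp; omega⟩

/-! #### The exchange property for simple left descents -/

open scoped Classical in
/-- The involution `(t, e) ↦ (s_i t s_i, e + [t = s_i])` of `W × ZMod 2`. -/
noncomputable def signedConj (i : B) (p : W × ZMod 2) : W × ZMod 2 :=
  (cs.simple i * p.1 * cs.simple i, p.2 + if p.1 = cs.simple i then 1 else 0)

open scoped Classical in
theorem foldr_signedConj (ω : List B) (p : W × ZMod 2) :
    ω.foldr cs.signedConj p =
      (cs.wordProd ω * p.1 * (cs.wordProd ω)⁻¹, p.2 + ((cs.rightInvSeq ω).count p.1 : ℕ)) := by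
  induction ω with
  | nil => simp
  | cons i ω ih =>
    rw [List.foldr_cons, ih, rightInvSeq, signedConj]
    ext
    · simp [wordProd_cons, mul_assoc]
    · have : (cs.wordProd ω * p.1 * (cs.wordProd ω)⁻¹ = cs.simple i) ↔
          ((cs.wordProd ω)⁻¹ * cs.simple i * cs.wordProd ω = p.1) := by
        constructor
        · intro h; rw [← h]; group
        · intro h; rw [← h]; group
      simp only [this, List.count_cons, beq_iff_eq, Nat.cast_add, Nat.cast_ite, Nat.cast_one,
        Nat.cast_zero, add_assoc]

theorem even_count_leftInvSeq_alternatingWord [DecidableEq W] (i j : B) (t : W) :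
    Even ((cs.leftInvSeq (alternatingWord i j (2 * M i j))).count t) := by
  set l := cs.leftInvSeq (alternatingWord i j (2 * M i j)) with hl
  have hlen : l.length = 2 * M i j := by simp [hl]
  have key : l.drop (M i j) = l.take (M i j) := by
    apply List.ext_getElem
    · simp [hlen]; omega
    · intro k h1 h2
      simp only [List.length_take, hlen] at h2
      have hk : k < M i j := by omega
      simp only [List.getElem_drop, List.getElem_take, hl]
      rw [cs.getElem_leftInvSeq_alternatingWord i j _ _ (by omega),
        cs.getElem_leftInvSeq_alternatingWord i j _ _ (by omega)]
      rw [prod_alternatingWord_eq_mul_pow, prod_alternatingWord_eq_mul_pow]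
      have e1 : (2 * (M i j + k) + 1) / 2 = M i j + k := by omega
      have e2 : (2 * k + 1) / 2 = k := by omega
      rw [e1, e2, pow_add, cs.simple_mul_simple_pow', one_mul]
      simp
  rw [← List.take_append_drop (M i j) l, key, List.count_append]
  exact ⟨_, rfl⟩

theorem signedConj_isLiftable :
    M.IsLiftable (fun i => (show Function.End (W × ZMod 2) from cs.signedConj i)) := by
  classical
  intro i j
  have h1 : ∀ n : ℕ, ∀ p, (((show Function.End (W × ZMod 2) from cs.signedConj i) *
      (show Function.End (W × ZMod 2) from cs.signedConj j)) ^ n : Function.End (W × ZMod 2)) p =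
      (alternatingWord i j (2 * n)).foldr cs.signedConj p := by
    intro n
    induction n with
    | zero => intro p; rfl
    | succ n ih =>
      intro p
      rw [show 2 * (n + 1) = 2 * n + 1 + 1 by ring, alternatingWord_succ', alternatingWord_succ',
        pow_succ']
      have : ¬ Even (2 * n + 1) := by simp
      rw [if_neg this, if_pos (by simp), List.foldr_cons, List.foldr_cons, ← ih]
      rfl
  funext p
  rw [h1, foldr_signedConj]
  have hw : cs.wordProd (alternatingWord i j (2 * M i j)) = 1 := by
    rw [prod_alternatingWord_eq_mul_pow]; simp
  have hc : Even ((cs.rightInvSeq (alternatingWord i j (2 * M i j))).count p.1) := by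
    have h2 := cs.even_count_leftInvSeq_alternatingWord j i p.1
    have h3 : alternatingWord i j (2 * M i j) = (alternatingWord j i (2 * M j i)).reverse := by
      rw [M.symmetric j i]
      apply List.ext_getElem
      · simp
      · intro k ha hb
        simp only [length_alternatingWord] at ha
        rw [List.getElem_reverse, getElem_alternatingWord _ _ _ _ ha,
          getElem_alternatingWord _ _ _ _ (by simp; omega)]
        simp only [length_alternatingWord]
        grind
    rw [h3, rightInvSeq_reverse, List.count_reverse]
    exact h2
  have h4 : (((cs.rightInvSeq (alternatingWord i j (2 * M i j))).count p.1 : ℕ) : ZMod 2) = 0 :=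
    (ZMod.natCast_eq_zero_iff_even).2 hc
  rw [hw, h4]
  simp
  rfl

theorem foldr_signedConj_congr {ω ω' : List B} (h : cs.wordProd ω = cs.wordProd ω')
    (p : W × ZMod 2) : ω.foldr cs.signedConj p = ω'.foldr cs.signedConj p := by
  have key : ∀ ω : List B, ω.foldr cs.signedConj p =
      (show Function.End (W × ZMod 2) from cs.lift ⟨_, cs.signedConj_isLiftable⟩ (cs.wordProd ω)) p := by
    intro ω
    induction ω with
    | nil => simp; rfl
    | cons i ω ih =>
      rw [List.foldr_cons, ih, wordProd_cons, map_mul, lift_apply_simple]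
      rfl
  rw [key, key, h]

theorem count_rightInvSeq_congr [DecidableEq W] {ω ω' : List B}
    (h : cs.wordProd ω = cs.wordProd ω') (t : W) :
    (((cs.rightInvSeq ω).count t : ℕ) : ZMod 2) = ((cs.rightInvSeq ω').count t : ℕ) := by
  have := cs.foldr_signedConj_congr h (t, 0)
  rw [foldr_signedConj, foldr_signedConj] at this
  have h2 := congrArg Prod.snd this
  simp only [zero_add] at h2
  convert h2

theorem simple_mem_rightInvSeq {ω : List B} {i : B}
    (h : cs.IsRightDescent (cs.wordProd ω) i) : cs.simple i ∈ cs.rightInvSeq ω := by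
  classical
  by_contra hmem
  obtain ⟨ω', hred, hω'⟩ := cs.exists_isReduced (cs.wordProd ω * cs.simple i)
  have hc := cs.count_rightInvSeq_congr (ω := ω) (ω' := ω'.concat i)
    (by rw [wordProd_concat, ← hω', simple_mul_simple_cancel_right]) (cs.simple i)
  rw [List.count_eq_zero_of_not_mem hmem, rightInvSeq_concat, List.concat_eq_append,
    List.count_append] at hc
  have h3 : cs.simple i ∉ (cs.rightInvSeq ω').map (MulAut.conj (cs.simple i)) := by
    intro hm
    obtain ⟨t, ht, ht'⟩ := List.mem_map.1 hm
    have : t = cs.simple i := by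
      have := congrArg (fun x => cs.simple i * x * cs.simple i) ht'
      simpa [mul_assoc] using this
    subst this
    have h5 := (cs.isRightInversion_of_mem_rightInvSeq hred ht).2
    rw [← hω', simple_mul_simple_cancel_right] at h5
    exact absurd h (by unfold IsRightDescent; omega)
  rw [List.count_eq_zero_of_not_mem h3] at hc
  simp at hc

theorem simple_mem_leftInvSeq {ω : List B} {i : B}
    (h : cs.IsLeftDescent (cs.wordProd ω) i) : cs.simple i ∈ cs.leftInvSeq ω := by
  have h' : cs.IsRightDescent (cs.wordProd ω.reverse) i := by
    rw [wordProd_reverse, isRightDescent_inv_iff]; exact h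
  have := cs.simple_mem_rightInvSeq h'
  rwa [rightInvSeq_reverse, List.mem_reverse] at this

/-- The exchange property. -/
theorem exists_eraseIdx {ω : List B} {i : B} (h : cs.IsLeftDescent (cs.wordProd ω) i) :
    ∃ k < ω.length, cs.simple i * cs.wordProd ω = cs.wordProd (ω.eraseIdx k) := by
  obtain ⟨k, hk, hk'⟩ := List.mem_iff_getElem.1 (cs.simple_mem_leftInvSeq h)
  refine ⟨k, by simpa using hk, ?_⟩
  rw [← cs.getD_leftInvSeq_mul_wordProd, List.getD_eq_getElem _ _ hk, hk']

/-- If `s w` and `w t` are longer than `w` and `s w t` is shorter than `w t`, then `s w = w t`. -/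
theorem simple_mul_eq_mul_simple {w : W} {i j : B} (hi : ¬ cs.IsLeftDescent w i)
    (hij : cs.IsLeftDescent (w * cs.simple j) i) :
    cs.simple i * w = w * cs.simple j := by
  obtain ⟨ω, hred, rfl⟩ := cs.exists_isReduced w
  rw [← wordProd_concat] at hij
  obtain ⟨k, hk, hk'⟩ := cs.exists_eraseIdx hij
  rw [List.concat_eq_append] at hk hk'
  by_cases hlt : k < ω.length
  · exfalso
    rw [List.eraseIdx_append_of_lt_length hlt, wordProd_append, wordProd_append, ← mul_assoc,
      mul_left_inj] at hk'
    apply hi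
    unfold IsLeftDescent
    rw [hk', hred.eq]
    refine lt_of_le_of_lt (cs.length_wordProd_le _) ?_
    rw [List.length_eraseIdx_of_lt hlt]; omega
  · have hk2 : k = ω.length := by simp at hk; omega
    subst hk2
    rw [List.eraseIdx_append_of_length_le le_rfl] at hk'
    simp only [wordProd_append, wordProd_singleton, Nat.sub_self, List.eraseIdx_zero,
      List.tail_cons, wordProd_nil, mul_one] at hk'
    rw [← mul_assoc] at hk'
    have := congrArg (· * cs.simple j) hk'
    simpa using this

/-! #### The action of the `0`-Hecke monoid on `W` -/

open scoped Classical in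
/-- `w` if `s_i` is a left descent of `w`, and `s_i w` otherwise. -/
noncomputable def leftStep (i : B) (w : W) : W :=
  if cs.IsLeftDescent w i then w else cs.simple i * w

open scoped Classical in
/-- `w` if `s_j` is a right descent of `w`, and `w s_j` otherwise. -/
noncomputable def rightStep (j : B) (w : W) : W :=
  if cs.IsRightDescent w j then w else w * cs.simple j

theorem leftStep_rightStep (i j : B) (w : W) :
    cs.leftStep i (cs.rightStep j w) = cs.rightStep j (cs.leftStep i w) := by
  have a1 := cs.length_simple_mul w i
  have a2 := cs.length_mul_simple w j
  have a3 := cs.length_simple_mul (w * cs.simple j) i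
  have a4 := cs.length_mul_simple (cs.simple i * w) j
  rw [mul_assoc] at a4
  by_cases hi : cs.IsLeftDescent w i <;> by_cases hj : cs.IsRightDescent w j
  · simp [leftStep, rightStep, hi, hj]
  · have : cs.IsLeftDescent (w * cs.simple j) i := by
      unfold IsLeftDescent IsRightDescent at *; omega
    simp [leftStep, rightStep, hi, hj, this]
  · have : cs.IsRightDescent (cs.simple i * w) j := by
      unfold IsLeftDescent IsRightDescent at *; rw [mul_assoc]; omega
    simp [leftStep, rightStep, hi, hj, this]
  · by_cases h : cs.IsLeftDescent (w * cs.simple j) i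
    · have h' := cs.simple_mul_eq_mul_simple hi h
      have : cs.IsRightDescent (cs.simple i * w) j := by
        unfold IsLeftDescent IsRightDescent at *; rw [mul_assoc]; omega
      simp [leftStep, rightStep, hi, hj, h, this]
      exact h'.symm
    · have : ¬ cs.IsRightDescent (cs.simple i * w) j := by
        unfold IsLeftDescent IsRightDescent at *; rw [mul_assoc]; omega
      simp [leftStep, rightStep, hi, hj, h, this, mul_assoc]

theorem foldr_leftStep_rightStep (ω : List B) (j : B) (w : W) :
    ω.foldr cs.leftStep (cs.rightStep j w) = cs.rightStep j (ω.foldr cs.leftStep w) := by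
  induction ω with
  | nil => rfl
  | cons i ω ih => rw [List.foldr_cons, ih, leftStep_rightStep, List.foldr_cons]

theorem foldr_leftStep_congr {ω ω' : List B}
    (h : ω.foldr cs.leftStep 1 = ω'.foldr cs.leftStep 1) (w : W) :
    ω.foldr cs.leftStep w = ω'.foldr cs.leftStep w := by
  induction hn : cs.length w using Nat.strong_induction_on generalizing w with
  | _ n ih =>
    by_cases hw : w = 1
    · rw [hw, h]
    · obtain ⟨j, hj⟩ := cs.exists_rightDescent_of_ne_one hw
      have hstep : w = cs.rightStep j (w * cs.simple j) := by
        have := cs.isRightDescent_iff_not_isRightDescent_mul.1 hj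
        simp [rightStep, this]
      rw [hstep, foldr_leftStep_rightStep, foldr_leftStep_rightStep,
        ih _ (by rw [← hn]; exact hj) _ rfl]

theorem foldr_leftStep_of_isReduced {ω : List B} (h : cs.IsReduced ω) :
    ω.foldr cs.leftStep 1 = cs.wordProd ω := by
  induction ω with
  | nil => simp
  | cons i ω ih =>
    have h' : cs.IsReduced ω := by simpa using h.drop 1
    rw [List.foldr_cons, ih h', wordProd_cons, leftStep, if_neg]
    unfold IsLeftDescent
    have := h.eq
    rw [wordProd_cons, List.length_cons] at this
    rw [this, h'.eq]; omega

theorem isReduced_alternatingWord_of_le {i j : B} {m k : ℕ} (hkm : k ≤ m)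
    (h : cs.IsReduced (alternatingWord i j m)) : cs.IsReduced (alternatingWord i j k) := by
  induction m with
  | zero => obtain rfl : k = 0 := by omega
            exact h
  | succ m ih =>
    by_cases hk : k = m + 1
    · rwa [hk]
    · refine ih (by omega) ?_
      rw [alternatingWord_succ'] at h
      simpa using h.drop 1

theorem wordProd_alternatingWord_comm {i j : B} {q : ℕ}
    (h : (cs.simple i * cs.simple j) ^ q = 1) :
    cs.wordProd (alternatingWord j i q) = cs.wordProd (alternatingWord i j q) := by
  have hinv : cs.simple j * cs.simple i = (cs.simple i * cs.simple j)⁻¹ := by simp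
  rw [prod_alternatingWord_eq_mul_pow, prod_alternatingWord_eq_mul_pow, hinv, inv_pow]
  rcases Nat.even_or_odd' q with ⟨n, rfl | rfl⟩
  · rw [if_pos (by simp), if_pos (by simp), show 2 * n / 2 = n by omega, one_mul, one_mul,
      inv_eq_iff_mul_eq_one, ← pow_add, ← two_mul, h]
  · rw [if_neg (by simp), if_neg (by simp), show (2 * n + 1) / 2 = n by omega,
      mul_inv_eq_iff_eq_mul]
    have h2 : cs.simple i * (cs.simple j * (cs.simple i * cs.simple j) ^ n *
        (cs.simple i * cs.simple j) ^ n) = 1 := by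
      rw [← h, mul_assoc, ← pow_add, ← mul_assoc, ← pow_succ', two_mul]
    have h3 := eq_inv_of_mul_eq_one_right h2
    rw [h3]; simp

/-- An alternating word is reduced, or its dihedral group has a longest element given by a
shorter alternating word. -/
theorem isReduced_alternatingWord_or (i j : B) (m : ℕ) :
    cs.IsReduced (alternatingWord i j m) ∨ ∃ q, 1 ≤ q ∧ q ≤ m ∧
      cs.IsReduced (alternatingWord i j q) ∧
      cs.wordProd (alternatingWord i j q) = cs.wordProd (alternatingWord j i q) := by
  induction m with
  | zero => left; simp [alternatingWord, IsReduced]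
  | succ m ih =>
    rcases ih with ih | ⟨q, h1, h2, h3⟩
    swap
    · exact Or.inr ⟨q, h1, by omega, h3⟩
    by_cases hr : cs.IsReduced (alternatingWord i j (m + 1))
    · exact Or.inl hr
    right
    set r := if Even m then j else i with hrdef
    have hlen := ih.eq
    have hdesc : cs.IsLeftDescent (cs.wordProd (alternatingWord i j m)) r := by
      by_contra hd
      apply hr
      rw [alternatingWord_succ', ← hrdef]
      unfold IsReduced
      rw [wordProd_cons, cs.not_isLeftDescent_iff.1 hd, hlen]; simp
    obtain ⟨k, hk, hk'⟩ := List.mem_iff_getElem.1 (cs.simple_mem_leftInvSeq hdesc)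
    rw [length_leftInvSeq, length_alternatingWord] at hk
    refine ⟨k + 1, by omega, by omega, cs.isReduced_alternatingWord_of_le (by omega) ih, ?_⟩
    have hfin : ∀ a b : B, alternatingWord i j m = (alternatingWord a b (2 * m)).take m → b = r →
        (cs.simple b * cs.simple a) ^ (k + 1) = 1 := by
      rintro a b hab hb
      have h1 : cs.simple b = cs.wordProd (alternatingWord b a (2 * k + 1)) := by
        rw [← cs.getElem_leftInvSeq_alternatingWord a b m k (by omega), hb, ← hk']
        simp only [hab, leftInvSeq_take, List.getElem_take, hb]
      rw [prod_alternatingWord_eq_mul_pow, if_neg (by simp),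
        show (2 * k + 1) / 2 = k by omega] at h1
      have h2 : cs.simple a * cs.simple b = (cs.simple b * cs.simple a) ^ k := by
        rw [h1, simple_mul_simple_cancel_left, ← h1]
      rw [pow_succ, ← h2]; simp [mul_assoc]
    rcases Nat.even_or_odd m with hm | hm
    · have := hfin i j (by rw [listTake_alternatingWord _ _ _ _ (by omega), if_pos hm])
        (by rw [hrdef, if_pos hm])
      have h1 : (cs.simple i * cs.simple j) ^ (k + 1) = 1 := by
        rw [← inv_eq_one, ← inv_pow]; simpa using this
      exact (cs.wordProd_alternatingWord_comm h1).symm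
    · have hm' := Nat.not_even_iff_odd.2 hm
      have := hfin j i (by rw [listTake_alternatingWord _ _ _ _ (by omega), if_neg hm'])
        (by rw [hrdef, if_neg hm'])
      have h1 : (cs.simple j * cs.simple i) ^ (k + 1) = 1 := by
        rw [← inv_eq_one, ← inv_pow]; simpa using this
      exact cs.wordProd_alternatingWord_comm h1

theorem leftStep_of_isLeftDescent {w : W} {i : B} (h : cs.IsLeftDescent w i) :
    cs.leftStep i w = w := if_pos h

theorem isLeftDescent_alternatingWord {i j : B} {q : ℕ}
    (h : cs.IsReduced (alternatingWord i j (q + 1))) :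
    cs.IsLeftDescent (cs.wordProd (alternatingWord i j (q + 1))) (if Even q then j else i) := by
  have h' := cs.isReduced_alternatingWord_of_le (Nat.le_succ q) h
  have e := h.eq
  rw [alternatingWord_succ'] at e ⊢
  rw [wordProd_cons] at e ⊢
  unfold IsLeftDescent
  rw [simple_mul_simple_cancel_left, h'.eq, e]
  simp

theorem foldr_leftStep_alternatingWord_eq {i j : B} {x : W} (hi : cs.IsLeftDescent x i)
    (hj : cs.IsLeftDescent x j) {q : ℕ}
    (hq : (alternatingWord i j q).foldr cs.leftStep 1 = x) {m : ℕ} (hm : q ≤ m) :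
    (alternatingWord i j m).foldr cs.leftStep 1 = x := by
  induction m, hm using Nat.le_induction with
  | base => exact hq
  | succ m _ ih =>
    rw [alternatingWord_succ', List.foldr_cons, ih]
    split_ifs
    · exact cs.leftStep_of_isLeftDescent hj
    · exact cs.leftStep_of_isLeftDescent hi

/-- The operators `leftStep` satisfy the braid relations. -/
theorem foldr_leftStep_braidWord (i j : B) (w : W) :
    (alternatingWord i j (M i j)).foldr cs.leftStep w =
      (alternatingWord j i (M i j)).foldr cs.leftStep w := by
  apply cs.foldr_leftStep_congr
  have hbr : cs.wordProd (alternatingWord i j (M i j)) =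
      cs.wordProd (alternatingWord j i (M i j)) := by
    have := cs.wordProd_braidWord_eq i j
    rwa [braidWord, braidWord, M.symmetric j i] at this
  rcases cs.isReduced_alternatingWord_or i j (M i j) with h | ⟨q, hq1, hqm, hred, heq⟩
  · have h' : cs.IsReduced (alternatingWord j i (M i j)) := by
      have e := h.eq
      unfold IsReduced
      rw [← hbr, e]; simp
    rw [cs.foldr_leftStep_of_isReduced h, cs.foldr_leftStep_of_isReduced h', hbr]
  · have hred' : cs.IsReduced (alternatingWord j i q) := by
      have e := hred.eq
      unfold IsReduced
      rw [← heq, e]; simp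
    obtain ⟨q, rfl⟩ : ∃ p, q = p + 1 := ⟨q - 1, by omega⟩
    have d1 := cs.isLeftDescent_alternatingWord hred
    have d2 := cs.isLeftDescent_alternatingWord hred'
    rw [← heq] at d2
    have hd : cs.IsLeftDescent (cs.wordProd (alternatingWord i j (q + 1))) i ∧
        cs.IsLeftDescent (cs.wordProd (alternatingWord i j (q + 1))) j := by
      by_cases he : Even q
      · rw [if_pos he] at d1 d2; exact ⟨d2, d1⟩
      · rw [if_neg he] at d1 d2; exact ⟨d1, d2⟩
    rw [cs.foldr_leftStep_alternatingWord_eq hd.1 hd.2 (cs.foldr_leftStep_of_isReduced hred) hqm,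
      cs.foldr_leftStep_alternatingWord_eq hd.2 hd.1
        ((cs.foldr_leftStep_of_isReduced hred').trans heq.symm) hqm]

theorem leftWeakLE_leftStep (i : B) (w : W) : cs.LeftWeakLE w (cs.leftStep i w) := by
  by_cases h : cs.IsLeftDescent w i
  · exact ⟨[], by simp [leftStep, h], by simp [leftStep, h]⟩
  · exact ⟨[i], by simp [leftStep, h], by simpa [leftStep, h] using cs.not_isLeftDescent_iff.1 h⟩

theorem leftWeakLE_foldr_leftStep (ω : List B) (w : W) :
    cs.LeftWeakLE w (ω.foldr cs.leftStep w) := by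
  induction ω with
  | nil => exact ⟨[], by simp, by simp⟩
  | cons i ω ih => exact ih.trans (cs.leftWeakLE_leftStep i _)

end CoxeterSystem

/-! ### Weak Bruhat interval modules -/

/-- The underlying vector space `K[u, v]_L` of the weak Bruhat interval module `B(u, v)`. -/
def IntervalModule {B W : Type*} [Group W] {M : CoxeterMatrix B} (K : Type*) [Field K]
    (cs : CoxeterSystem M W) (u v : W) : Type _ :=
  cs.leftInterval u v →₀ K

namespace IntervalModule

open CoxeterSystem

variable {B W : Type*} [Group W] {M : CoxeterMatrix B} (K : Type*) [Field K]
  (cs : CoxeterSystem M W) (u v : W)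

noncomputable instance instAddCommGroup : AddCommGroup (IntervalModule K cs u v) :=
  inferInstanceAs (AddCommGroup (cs.leftInterval u v →₀ K))

noncomputable instance instModuleField : Module K (IntervalModule K cs u v) :=
  inferInstanceAs (Module K (cs.leftInterval u v →₀ K))

/-- The basis `[u, v]_L` of `B(u, v)`. -/
noncomputable def basis : Module.Basis (cs.leftInterval u v) K (IntervalModule K cs u v) :=
  Module.Basis.ofRepr (LinearEquiv.refl K (cs.leftInterval u v →₀ K))

open scoped Classical in
/-- The value `π_i w` for a basis element `w` of `B(u, v)`: it is `w` if `s_i` is a left descent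
of `w`; otherwise it is `s_i w` if this element lies in `[u, v]_L`, and `0` if it does not. -/
noncomputable def genSMul (i : B) (w : cs.leftInterval u v) : IntervalModule K cs u v :=
  if cs.IsLeftDescent (w : W) i then basis K cs u v w
  else if h : cs.simple i * (w : W) ∈ cs.leftInterval u v then
    basis K cs u v ⟨cs.simple i * (w : W), h⟩
  else 0

/-- The linear operator by which the generator `π_i` acts on `B(u, v)`. -/
noncomputable def genEnd (i : B) : Module.End K (IntervalModule K cs u v) :=
  (basis K cs u v).constr K (genSMul K cs u v i)

open scoped Classical in
/-- The basis vector of `x` if `x ∈ [u, v]_L`, and `0` otherwise. -/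
noncomputable def basisOrZero (x : W) : IntervalModule K cs u v :=
  if h : x ∈ cs.leftInterval u v then basis K cs u v ⟨x, h⟩ else 0

variable {K cs u v}

theorem genEnd_basis (i : B) (w : cs.leftInterval u v) :
    genEnd K cs u v i (basis K cs u v w) = genSMul K cs u v i w := by
  simp [genEnd, Module.Basis.constr_basis]

theorem genSMul_eq (i : B) (w : cs.leftInterval u v) :
    genSMul K cs u v i w = basisOrZero K cs u v (cs.leftStep i w) := by
  by_cases h : cs.IsLeftDescent (w : W) i
  · simp [genSMul, basisOrZero, leftStep, h]
  · have e : cs.leftStep i (w : W) = cs.simple i * (w : W) := if_neg h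
    rw [genSMul, if_neg h, e, basisOrZero]

theorem prod_genEnd_basis (ω : List B) (w : cs.leftInterval u v) :
    (ω.map (genEnd K cs u v)).prod (basis K cs u v w) =
      basisOrZero K cs u v (ω.foldr cs.leftStep w) := by
  induction ω with
  | nil => simp [basisOrZero]
  | cons i ω ih =>
    rw [List.map_cons, List.prod_cons, Module.End.mul_apply, ih, List.foldr_cons]
    by_cases h : ω.foldr cs.leftStep (w : W) ∈ cs.leftInterval u v
    · have : basisOrZero K cs u v (ω.foldr cs.leftStep (w : W)) = basis K cs u v ⟨_, h⟩ :=
        dif_pos h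
      rw [this, genEnd_basis, genSMul_eq]
    · have h' : cs.leftStep i (ω.foldr cs.leftStep (w : W)) ∉ cs.leftInterval u v := fun h2 =>
        h ⟨w.2.1.trans (cs.leftWeakLE_foldr_leftStep ω w),
          (cs.leftWeakLE_leftStep i _).trans h2.2⟩
      rw [basisOrZero, basisOrZero, dif_neg h, dif_neg h', map_zero]

theorem lift_genEnd_rel {x y : FreeAlgebra K B} (h : ZeroHeckeRel K M x y) :
    FreeAlgebra.lift K (genEnd K cs u v) x = FreeAlgebra.lift K (genEnd K cs u v) y := by
  have hmap : ∀ ω : List B, FreeAlgebra.lift K (genEnd K cs u v)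
      (ω.map (FreeAlgebra.ι K)).prod = (ω.map (genEnd K cs u v)).prod := by
    intro ω
    rw [map_list_prod, List.map_map]
    congr 2
    funext i
    simp
  cases h with
  | idem i =>
    have h1 := hmap [i, i]
    have h2 := hmap [i]
    simp only [List.map_cons, List.map_nil, List.prod_cons, List.prod_nil, mul_one] at h1 h2
    rw [h1, h2]
    refine (basis K cs u v).ext fun w => ?_
    have e1 := prod_genEnd_basis (K := K) [i, i] w
    have e2 := prod_genEnd_basis (K := K) [i] w
    simp only [List.map_cons, List.map_nil, List.prod_cons, List.prod_nil, mul_one,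
      List.foldr_cons, List.foldr_nil] at e1 e2
    rw [e1, e2]
    congr 1
    by_cases h : cs.IsLeftDescent (w : W) i
    · simp [leftStep, h]
    · have := cs.isLeftDescent_iff_not_isLeftDescent_mul (w := cs.simple i * (w : W)) (i := i)
      rw [simple_mul_simple_cancel_left] at this
      simp [leftStep, h, this]
  | braid i j hij =>
    rw [hmap, hmap]
    refine (basis K cs u v).ext fun w => ?_
    rw [prod_genEnd_basis, prod_genEnd_basis, cs.foldr_leftStep_braidWord]

variable (K cs u v)

/-- The representation of the `0`-Hecke algebra on `B(u, v)`. -/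
noncomputable def rep : ZeroHecke K M →ₐ[K] Module.End K (IntervalModule K cs u v) :=
  RingQuot.liftAlgHom K
    ⟨FreeAlgebra.lift K (genEnd K cs u v), fun _ _ h => lift_genEnd_rel h⟩

/-- The weak Bruhat interval module `B(u, v)` as a module over the `0`-Hecke algebra. -/
noncomputable instance instModule : Module (ZeroHecke K M) (IntervalModule K cs u v) :=
  Module.compHom _ (rep K cs u v).toRingHom

variable {K cs u v}

theorem smul_def (a : ZeroHecke K M) (x : IntervalModule K cs u v) : a • x = rep K cs u v a x :=
  rfl

instance instIsScalarTower : IsScalarTower K (ZeroHecke K M) (IntervalModule K cs u v) where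
  smul_assoc c a x := by rw [smul_def, smul_def, map_smul]; rfl

theorem gen_smul_basis (i : B) (w : cs.leftInterval u v) :
    ZeroHecke.gen K M i • basis K cs u v w = genSMul K cs u v i w := by
  rw [smul_def, ← genEnd_basis, ZeroHecke.gen, rep]
  congr 1
  exact (RingQuot.liftAlgHom_mkAlgHom_apply K _ _ _).trans (FreeAlgebra.lift_ι_apply _ _)

end IntervalModule

/-- The module `P_I = B(u_I, v_I)` over the `0`-Hecke algebra. -/
abbrev ProjIndec {B W : Type*} [Group W] {M : CoxeterMatrix B} (K : Type*) [Field K]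
    (cs : CoxeterSystem M W) (I : Set B) : Type _ :=
  IntervalModule K cs (cs.shortest I) (cs.longest I)

/-- A module is indecomposable if it is nonzero and is not the (internal) direct sum of two
nonzero submodules. -/
def IsIndecomposable (R X : Type*) [Ring R] [AddCommGroup X] [Module R X] : Prop :=
  Nontrivial X ∧ ∀ N N' : Submodule R X, IsCompl N N' → N = ⊥ ∨ N' = ⊥

/-! ### Left weak order and Demazure products -/

namespace CoxeterSystem

variable {B W : Type*} [Group W] {M : CoxeterMatrix B} (cs : CoxeterSystem M W)

/-! The modules `B(w, v_I)` have a simple socle and the modules `B(u_I, w)` a simple top; `P_I` is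
an instance of both. A nonzero vector common to all nonzero submodules, or a proper submodule
containing all proper ones, rules out direct sum decompositions, and the first property passes to
submodules, the second to quotients. So it suffices that every nonzero submodule of `B(w, v_I)`
contains the basis vector `v_I` (`basisOrZero_right_mem`), and that every proper submodule of
`B(u_I, w)` lies in the span of the basis vectors other than `u_I` (`le_radical`).

The generators act triangularly with respect to length, with diagonal entries 0 and 1. Hence a
nonzero submodule contains a common eigenvector (`exists_eigenvector`), and the generator `u` is a
common eigenvector modulo any maximal submodule (`gen_smul_left_of_isCoatom`). It remains to
determine the eigenvalues.

The combinatorial input is that a shortest element `u` of a right descent class is the longest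
element of the parabolic subgroup generated by its right descents (`IsShortest.exists_word`). Let
`J` be the set of generators fixing `u` modulo a maximal submodule; it contains the right descents
of `u`. A word for the longest element of `W_J` does not change `u` modulo the submodule, so it
cannot take `u` out of the interval. But it takes `u` to an element with all of `J` as right
descents, while the right descents in the interval are those of `u`. Hence `J` consists of the right
descents of `u`; the other generators kill `u` modulo the submodule, which therefore contains all
other basis vectors.

For the socle, right multiplication by `w₀` turns the longest element `v` into a shortest one, and
the same argument, run downwards from `v` through the support of an eigenvector, shows that no left
descent of `v` kills the eigenvector. Any support element other than `v` would produce such a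
descent, so the eigenvector is a multiple of `v`. -/

theorem leftWeakLE_iff {u v : W} :
    cs.LeftWeakLE u v ↔ cs.length (v * u⁻¹) + cs.length u = cs.length v := by
  constructor
  · rintro ⟨ω, rfl, h⟩
    have h1 := cs.length_wordProd_le ω
    have h2 := cs.length_mul_le (cs.wordProd ω) u
    rw [mul_inv_cancel_right]
    omega
  · intro h
    obtain ⟨ω, hred, hω⟩ := cs.exists_isReduced (v * u⁻¹)
    refine ⟨ω, by rw [← hω]; simp, ?_⟩
    rw [← h, hω, hred.eq, add_comm]

variable {cs}

theorem LeftWeakLE.refl (w : W) : cs.LeftWeakLE w w := ⟨[], by simp, by simp⟩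

theorem LeftWeakLE.length_le {u v : W} (h : cs.LeftWeakLE u v) :
    cs.length u ≤ cs.length v := by
  rw [leftWeakLE_iff] at h; omega

theorem LeftWeakLE.eq_of_length_le {u v : W} (h : cs.LeftWeakLE u v)
    (h' : cs.length v ≤ cs.length u) : u = v := by
  obtain ⟨ω, rfl, hω⟩ := h
  obtain rfl : ω = [] := List.length_eq_zero_iff.1 (by omega)
  simp

/-- Consequently right descent sets are constant on an interval whose endpoints have the same right
descents. -/
theorem LeftWeakLE.isRightDescent {u v : W} (h : cs.LeftWeakLE u v) {i : B}
    (hi : cs.IsRightDescent u i) : cs.IsRightDescent v i := by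
  obtain ⟨ω, rfl, hω⟩ := h
  unfold IsRightDescent at *
  have h1 := cs.length_mul_le (cs.wordProd ω) (u * cs.simple i)
  have h2 := cs.length_wordProd_le ω
  rw [mul_assoc]
  omega

variable (cs)

/-- Additivity of length means that no letter is absorbed, so the Demazure action is plain
multiplication. -/
theorem foldr_leftStep_of_length_eq {ω : List B} {u : W}
    (h : cs.length (cs.wordProd ω * u) = cs.length u + ω.length) :
    ω.foldr cs.leftStep u = cs.wordProd ω * u := by
  induction ω with
  | nil => simp
  | cons i ω ih =>
    rw [wordProd_cons, mul_assoc, List.length_cons] at h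
    have h1 := cs.length_mul_le (cs.wordProd ω) u
    have h2 := cs.length_wordProd_le ω
    have h3 := cs.length_simple_mul (cs.wordProd ω * u) i
    rw [List.foldr_cons, ih (by omega), leftStep, if_neg, wordProd_cons, mul_assoc]
    unfold IsLeftDescent
    omega

variable {cs} in
theorem LeftWeakLE.exists_foldr {u v : W} (h : cs.LeftWeakLE u v) :
    ∃ ω : List B, ω.foldr cs.leftStep u = v ∧ cs.length v = cs.length u + ω.length := by
  obtain ⟨ω, rfl, hω⟩ := h
  exact ⟨ω, cs.foldr_leftStep_of_length_eq hω, hω⟩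

theorem exists_foldr_leftStep_one (w : W) : ∃ ω : List B, ω.foldr cs.leftStep 1 = w := by
  obtain ⟨ω, hred, rfl⟩ := cs.exists_isReduced w
  exact ⟨ω, cs.foldr_leftStep_of_isReduced hred⟩

theorem leftStep_one (i : B) : cs.leftStep i 1 = cs.rightStep i 1 := by
  simp [leftStep, rightStep, not_isLeftDescent_one, not_isRightDescent_one]

/-- Left and right steps agree at `1` and commute, so a Demazure product can also be extended on the
right. -/
theorem foldr_leftStep_append_singleton (ω : List B) (j : B) :
    (ω ++ [j]).foldr cs.leftStep 1 = cs.rightStep j (ω.foldr cs.leftStep 1) := by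
  rw [List.foldr_append, List.foldr_cons, List.foldr_nil, leftStep_one, foldr_leftStep_rightStep]

theorem foldr_leftStep_append_of_isRightDescent (ω η : List B)
    (h : ∀ i ∈ η, cs.IsRightDescent (ω.foldr cs.leftStep 1) i) :
    (ω ++ η).foldr cs.leftStep 1 = ω.foldr cs.leftStep 1 := by
  induction η using List.reverseRecOn with
  | nil => simp
  | append_singleton η j ih =>
    rw [← List.append_assoc, foldr_leftStep_append_singleton,
      ih fun i hi => h i (by simp [hi]), rightStep, if_pos (h j (by simp))]

/-- If all letters of `η` are right descents of `w`, then the Demazure product of `η` lies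
below `w`. -/
theorem foldr_leftStep_leftWeakLE {η : List B} {w : W} (h : ∀ i ∈ η, cs.IsRightDescent w i) :
    cs.LeftWeakLE (η.foldr cs.leftStep 1) w := by
  obtain ⟨ω, rfl⟩ := cs.exists_foldr_leftStep_one w
  have := cs.foldr_leftStep_append_of_isRightDescent ω η h
  rw [List.foldr_append] at this
  exact this ▸ cs.leftWeakLE_foldr_leftStep ω _

theorem isRightDescent_of_length_rightStep_le {w : W} {j : B}
    (h : cs.length (cs.rightStep j w) ≤ cs.length w) : cs.IsRightDescent w j := by
  by_contra hj
  rw [rightStep, if_neg hj] at h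
  have := cs.length_mul_simple_ne w j
  exact hj (by unfold IsRightDescent; omega)

theorem isLeftDescent_of_length_leftStep_le {w : W} {j : B}
    (h : cs.length (cs.leftStep j w) ≤ cs.length w) : cs.IsLeftDescent w j := by
  by_contra hj
  rw [leftStep, if_neg hj] at h
  have := cs.length_simple_mul_ne w j
  exact hj (by unfold IsLeftDescent; omega)

theorem leftStep_eq_self_iff {w : W} {j : B} :
    cs.leftStep j w = w ↔ cs.IsLeftDescent w j :=
  ⟨fun h => cs.isLeftDescent_of_length_leftStep_le (by rw [h]), fun h => if_pos h⟩

/-- The longest element of the parabolic subgroup of `J`, as a Demazure product. -/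
theorem exists_word_all_descents [Finite W] (J : Set B) : ∃ ω : List B, (∀ i ∈ ω, i ∈ J) ∧
    (∀ i ∈ J, cs.IsRightDescent (ω.foldr cs.leftStep 1) i) ∧
    ∀ i ∈ J, cs.IsLeftDescent (ω.foldr cs.leftStep 1) i := by
  obtain ⟨z, ⟨ω, hω, rfl⟩, hmax⟩ := Set.exists_max_image
    {z : W | ∃ ω : List B, (∀ i ∈ ω, i ∈ J) ∧ ω.foldr cs.leftStep 1 = z} cs.length
    (Set.toFinite _) ⟨1, [], by simp, by simp⟩
  refine ⟨ω, hω, fun i hi => ?_, fun i hi => ?_⟩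
  · apply cs.isRightDescent_of_length_rightStep_le
    rw [← foldr_leftStep_append_singleton]
    exact hmax _ ⟨_, by simpa [or_imp, forall_and] using ⟨hω, hi⟩, rfl⟩
  · apply cs.isLeftDescent_of_length_leftStep_le
    exact hmax _ ⟨i :: ω, by simpa using ⟨hi, hω⟩, rfl⟩

/-! ### Shortest and longest elements of descent classes -/

/-- `u` is a shortest element of its right descent class. -/
def IsShortest (u : W) : Prop :=
  ∀ w, (∀ i, cs.IsRightDescent w i ↔ cs.IsRightDescent u i) → cs.length u ≤ cs.length w

/-- `v` is a longest element of its right descent class. -/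
def IsLongest (v : W) : Prop :=
  ∀ w, (∀ i, cs.IsRightDescent w i ↔ cs.IsRightDescent v i) → cs.length w ≤ cs.length v

variable {cs}

/-- The longest element of the parabolic subgroup of the right descents of `u` lies below `u` and
has the same right descents, so minimality of `u` makes them equal. Right descents of `u` are then
left descents too. -/
theorem IsShortest.exists_word [Finite W] {u : W} (hu : cs.IsShortest u) :
    ∃ ω : List B, ω.foldr cs.leftStep 1 = u ∧ (∀ i ∈ ω, cs.IsRightDescent u i) ∧
      ∀ i, cs.IsRightDescent u i → cs.IsLeftDescent u i := by
  obtain ⟨ω, hω, hr, hl⟩ := cs.exists_word_all_descents {i | cs.IsRightDescent u i}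
  have hle := cs.foldr_leftStep_leftWeakLE (w := u) hω
  have heq := hle.eq_of_length_le (hu _ fun i => ⟨hle.isRightDescent, hr i⟩)
  rw [heq] at hl
  exact ⟨ω, heq, hω, hl⟩

theorem IsShortest.leftWeakLE [Finite W] {u w : W} (hu : cs.IsShortest u)
    (h : ∀ i, cs.IsRightDescent u i → cs.IsRightDescent w i) : cs.LeftWeakLE u w := by
  obtain ⟨ω, rfl, hω, -⟩ := hu.exists_word
  exact cs.foldr_leftStep_leftWeakLE fun i hi => h i (hω i hi)

/-- The longest element of `W_J` absorbs `u` on its right, because `u` is a Demazure product of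
letters of `J`; the result is that longest element. This is what forces a set of generators with
equal eigenvalue down to the descents of `u`. -/
theorem IsShortest.exists_foldr_isRightDescent [Finite W] {u : W} (hu : cs.IsShortest u)
    {J : Set B} (hJ : ∀ i, cs.IsRightDescent u i → i ∈ J) {t : B} (ht : t ∈ J) :
    ∃ ω : List B, (∀ i ∈ ω, i ∈ J) ∧ cs.IsRightDescent (ω.foldr cs.leftStep u) t := by
  obtain ⟨ω, hω, hr, -⟩ := cs.exists_word_all_descents J
  obtain ⟨η, hη, hη', -⟩ := hu.exists_word
  refine ⟨ω, hω, ?_⟩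
  rw [← hη, ← List.foldr_append,
    cs.foldr_leftStep_append_of_isRightDescent ω η fun i hi => hr i (hJ i (hη' i hi))]
  exact hr t ht

/-! ### Duality by the longest element -/

variable (cs)

/-- Multiplication by the longest element reverses the left weak order. -/
theorem exists_length_mul_add [Finite W] :
    ∃ w₀ : W, w₀ * w₀ = 1 ∧ ∀ w, cs.length (w * w₀) + cs.length w = cs.length w₀ := by
  obtain ⟨ω, -, hr, -⟩ := cs.exists_word_all_descents Set.univ
  set w₀ := ω.foldr cs.leftStep 1
  have hle : ∀ w, cs.LeftWeakLE w w₀ := by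
    intro w
    obtain ⟨η, rfl⟩ := cs.exists_foldr_leftStep_one w
    exact cs.foldr_leftStep_leftWeakLE fun i _ => hr i trivial
  have hinv : w₀⁻¹ = w₀ := (hle w₀⁻¹).eq_of_length_le (by rw [length_inv])
  refine ⟨w₀, by rw [mul_eq_one_iff_inv_eq, hinv], fun w => ?_⟩
  have := cs.leftWeakLE_iff.1 (hle w)
  rwa [← cs.length_inv, mul_inv_rev, inv_inv, hinv] at this

variable {cs}

theorem isLeftDescent_mul_longest {w₀ : W}
    (h2 : ∀ w, cs.length (w * w₀) + cs.length w = cs.length w₀)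
    {w : W} {i : B} :
    cs.IsLeftDescent (w * w₀) i ↔ ¬ cs.IsLeftDescent w i := by
  have a1 := h2 w
  have a2 := h2 (cs.simple i * w)
  have a3 := cs.length_simple_mul_ne w i
  unfold IsLeftDescent
  rw [← mul_assoc]
  omega

/-- Conjugation by `w₀` permutes the simple reflections, so the right descents of `w * w₀` are the
conjugates of the right ascents of `w`. Thus right multiplication by `w₀` permutes descent classes.
-/
theorem isRightDescent_mul_longest_congr {w₀ : W} (h1 : w₀ * w₀ = 1)
    (h2 : ∀ w, cs.length (w * w₀) + cs.length w = cs.length w₀) {w w' : W}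
    (h : ∀ i, cs.IsRightDescent w i ↔ cs.IsRightDescent w' i) (i : B) :
    cs.IsRightDescent (w * w₀) i ↔ cs.IsRightDescent (w' * w₀) i := by
  have hinv : w₀⁻¹ = w₀ := inv_eq_of_mul_eq_one_left h1
  -- Complementing lengths twice gives the conjugate the length of `s_i`, which is 1.
  obtain ⟨j, hj⟩ : ∃ j, w₀ * cs.simple i * w₀ = cs.simple j := by
    apply cs.length_eq_one_iff.1
    have a1 := h2 (w₀ * cs.simple i)
    have a2 := h2 (cs.simple i)
    have a3 : cs.length (w₀ * cs.simple i) = cs.length (cs.simple i * w₀) := by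
      rw [← cs.length_inv, mul_inv_rev, hinv, inv_simple]
    rw [length_simple] at a2
    omega
  have key : ∀ w, cs.IsRightDescent (w * w₀) i ↔ ¬ cs.IsRightDescent w j := by
    intro w
    have e : w * w₀ * cs.simple i * w₀ = w * cs.simple j := by rw [← hj]; simp [mul_assoc]
    have a1 := h2 (w * w₀ * cs.simple i)
    have a2 := h2 w
    have a3 := cs.length_mul_simple_ne w j
    rw [e] at a1
    unfold IsRightDescent
    omega
  rw [key, key, h]

theorem IsLongest.isShortest_mul {w₀ : W} (h1 : w₀ * w₀ = 1)
    (h2 : ∀ w, cs.length (w * w₀) + cs.length w = cs.length w₀)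
    {v : W} (hv : cs.IsLongest v) : cs.IsShortest (v * w₀) := by
  intro w hw
  have a1 := hv (w * w₀) fun i => by
    simpa only [mul_assoc, h1, mul_one] using isRightDescent_mul_longest_congr h1 h2 hw i
  have a2 := h2 w
  have a3 := h2 v
  omega

theorem leftWeakLE_of_mul_longest {w₀ : W}
    (h2 : ∀ w, cs.length (w * w₀) + cs.length w = cs.length w₀)
    {u v : W} (h : cs.LeftWeakLE (v * w₀) (u * w₀)) :
    cs.LeftWeakLE u v := by
  rw [leftWeakLE_iff] at h ⊢
  have a1 := h2 u
  have a2 := h2 v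
  have e : cs.length (u * w₀ * (v * w₀)⁻¹) = cs.length (v * u⁻¹) := by
    rw [← cs.length_inv]; simp [mul_assoc]
  omega

theorem IsLongest.leftWeakLE [Finite W] {v w : W} (hv : cs.IsLongest v)
    (h : ∀ i, cs.IsRightDescent w i ↔ cs.IsRightDescent v i) : cs.LeftWeakLE w v := by
  obtain ⟨w₀, h1, h2⟩ := cs.exists_length_mul_add
  exact leftWeakLE_of_mul_longest h2 <| (IsLongest.isShortest_mul h1 h2 hv).leftWeakLE fun i =>
    (isRightDescent_mul_longest_congr h1 h2 h i).2

variable (cs)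

theorem isShortest_shortest_and_isLongest_longest [Finite W] (I : Set B) :
    cs.IsShortest (cs.shortest I) ∧ cs.IsLongest (cs.longest I) ∧
      ∀ i, cs.IsRightDescent (cs.shortest I) i ↔ cs.IsRightDescent (cs.longest I) i := by
  have hmem : ∀ {w w' : W}, w' ∈ cs.descentClass I →
      (∀ i, cs.IsRightDescent w i ↔ cs.IsRightDescent w' i) → w ∈ cs.descentClass I := by
    intro w w' h h'
    rw [← h]
    ext i
    exact h' i
  by_cases hne : (cs.descentClass I).Nonempty
  · have hs := Set.exists_min_image _ cs.length (Set.toFinite _) hne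
    have hl := Set.exists_max_image _ cs.length (Set.toFinite _) hne
    rw [shortest, dif_pos hs, longest, dif_pos hl]
    obtain ⟨s1, s2⟩ := hs.choose_spec
    obtain ⟨l1, l2⟩ := hl.choose_spec
    exact ⟨fun w hw => s2 w (hmem s1 hw), fun w hw => l2 w (hmem l1 hw),
      fun i => (Set.ext_iff.1 s1 i).trans (Set.ext_iff.1 l1 i).symm⟩
  · have hs : ¬ ∃ u ∈ cs.descentClass I, ∀ w ∈ cs.descentClass I, cs.length u ≤ cs.length w :=
      fun ⟨u, hu, _⟩ => hne ⟨u, hu⟩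
    have hl : ¬ ∃ u ∈ cs.descentClass I, ∀ w ∈ cs.descentClass I, cs.length w ≤ cs.length u :=
      fun ⟨u, hu, _⟩ => hne ⟨u, hu⟩
    rw [shortest, dif_neg hs, longest, dif_neg hl]
    -- For an empty class both default values are `1`, which is shortest and longest in its own
    -- class, being the only element without right descents. So nonemptiness of descent classes is
    -- not needed.
    refine ⟨fun w _ => by simp, fun w hw => ?_, fun i => Iff.rfl⟩
    by_contra hw'
    have : w ≠ 1 := by rintro rfl; simp at hw'
    obtain ⟨i, hi⟩ := cs.exists_rightDescent_of_ne_one this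
    exact cs.not_isRightDescent_one i ((hw i).1 hi)

theorem isRightDescent_iff_of_mem_descentClass [Finite W] {I : Set B} {w : W}
    (hw : w ∈ cs.descentClass I) (i : B) :
    cs.IsRightDescent w i ↔ cs.IsRightDescent (cs.longest I) i := by
  have hl := Set.exists_max_image _ cs.length (Set.toFinite (cs.descentClass I)) ⟨w, hw⟩
  rw [longest, dif_pos hl]
  exact (Set.ext_iff.1 hw i).trans (Set.ext_iff.1 hl.choose_spec.1 i).symm

end CoxeterSystem

/-! ### Reduction to the generators of the 0-Hecke algebra -/

theorem ZeroHecke.induction {B : Type*} {K : Type*} [Field K] {M : CoxeterMatrix B}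
    {P : ZeroHecke K M → Prop} (halg : ∀ c : K, P (algebraMap K _ c))
    (hgen : ∀ i, P (gen K M i)) (hmul : ∀ a b, P a → P b → P (a * b))
    (hadd : ∀ a b, P a → P b → P (a + b)) (a : ZeroHecke K M) : P a := by
  obtain ⟨a, rfl⟩ := RingQuot.mkAlgHom_surjective K (ZeroHeckeRel K M) a
  induction a using FreeAlgebra.induction with
  | grade0 r => exact (AlgHom.commutes (RingQuot.mkAlgHom K (ZeroHeckeRel K M)) r).symm ▸ halg r
  | grade1 x => exact hgen x
  | mul a b ha hb =>
    exact (map_mul (RingQuot.mkAlgHom K (ZeroHeckeRel K M)) a b).symm ▸ hmul _ _ ha hb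
  | add a b ha hb =>
    exact (map_add (RingQuot.mkAlgHom K (ZeroHeckeRel K M)) a b).symm ▸ hadd _ _ ha hb

theorem ZeroHecke.smul_mem_of_gen_smul_mem {B : Type*} {K : Type*} [Field K] {M : CoxeterMatrix B}
    {X : Type*} [AddCommGroup X] [Module K X] [Module (ZeroHecke K M) X]
    [IsScalarTower K (ZeroHecke K M) X] (P : Submodule K X)
    (hP : ∀ i, ∀ x ∈ P, gen K M i • x ∈ P) (a : ZeroHecke K M) : ∀ x ∈ P, a • x ∈ P := by
  induction a using ZeroHecke.induction with
  | halg c =>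
    intro x hx
    rw [Algebra.algebraMap_eq_smul_one, smul_assoc, one_smul]
    exact P.smul_mem c hx
  | hgen i => exact hP i
  | hmul a b ha hb => intro x hx; rw [mul_smul]; exact ha _ (hb _ hx)
  | hadd a b ha hb => intro x hx; rw [add_smul]; exact P.add_mem (ha _ hx) (hb _ hx)

/-! ### Indecomposability from a common vector or a largest proper submodule -/

section Indecomposable

variable {R X : Type*} [Ring R] [AddCommGroup X] [Module R X]

theorem isIndecomposable_of_mem {x : X} (hx : x ≠ 0)
    (h : ∀ N : Submodule R X, N ≠ ⊥ → x ∈ N) : IsIndecomposable R X := by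
  refine ⟨⟨x, 0, hx⟩, fun N N' hN => ?_⟩
  by_contra! hne
  exact hx (Submodule.disjoint_def.1 hN.disjoint _ (h N hne.1) (h N' hne.2))

/-- Nonzero submodules are indecomposable if all of them contain a common nonzero vector. -/
theorem isIndecomposable_submodule {x : X} (hx : x ≠ 0)
    (h : ∀ N : Submodule R X, N ≠ ⊥ → x ∈ N) (N : Submodule R X) (hN : N ≠ ⊥) :
    IsIndecomposable R N := by
  refine isIndecomposable_of_mem (x := ⟨x, h N hN⟩) (fun h' => hx (congrArg Subtype.val h'))
    fun C hC => ?_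
  obtain ⟨y, hy, hyx⟩ := h (C.map N.subtype) fun h' =>
    hC (Submodule.map_injective_of_injective N.injective_subtype (by rw [h', Submodule.map_bot]))
  have : y = ⟨x, h N hN⟩ := Subtype.ext hyx
  exact this ▸ hy

theorem isIndecomposable_of_le {Q : Submodule R X} (hQ : Q ≠ ⊤)
    (h : ∀ N : Submodule R X, N ≠ ⊤ → N ≤ Q) : IsIndecomposable R X := by
  refine ⟨?_, fun N N' hN => ?_⟩
  · by_contra! hX
    exact hQ (Subsingleton.elim _ _)
  · by_contra! hne
    apply hQ
    rw [eq_top_iff, ← hN.sup_eq_top]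
    refine sup_le (h N ?_) (h N' ?_)
    · rintro rfl
      exact hne.2 (top_disjoint.1 hN.disjoint)
    · rintro rfl
      exact hne.1 (disjoint_top.1 hN.disjoint)

/-- Nonzero quotients are indecomposable if there is a largest proper submodule. -/
theorem isIndecomposable_quotient {Q : Submodule R X} (hQ : Q ≠ ⊤)
    (h : ∀ N : Submodule R X, N ≠ ⊤ → N ≤ Q) (N : Submodule R X) (hN : N ≠ ⊤) :
    IsIndecomposable R (X ⧸ N) := by
  have hsurj := N.mkQ_surjective
  refine isIndecomposable_of_le (Q := Q.map N.mkQ) (fun htop => hQ ?_) fun C hC => ?_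
  · rw [eq_top_iff, ← Submodule.comap_top N.mkQ, ← htop, Submodule.comap_map_eq]
    simp [h N hN]
  · have h1 : C.comap N.mkQ ≠ ⊤ := fun h2 => hC <|
      Submodule.comap_injective_of_surjective hsurj (by rw [h2, Submodule.comap_top])
    have := Submodule.map_mono (f := N.mkQ) (h _ h1)
    rwa [Submodule.map_comap_eq_of_surjective hsurj] at this

end Indecomposable

/-! ### Coefficients in interval modules -/

namespace IntervalModule

open CoxeterSystem

variable {B W : Type*} [Group W] {M : CoxeterMatrix B} {K : Type*} [Field K]
  {cs : CoxeterSystem M W} {u v : W}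

theorem basisOrZero_of_mem {x : W} (h : x ∈ cs.leftInterval u v) :
    basisOrZero K cs u v x = basis K cs u v ⟨x, h⟩ := dif_pos h

theorem basisOrZero_of_notMem {x : W} (h : x ∉ cs.leftInterval u v) :
    basisOrZero K cs u v x = 0 := dif_neg h

/-- An element above `u` that has left the interval is no longer below `v`, and nothing above it is
either. Without `hx` a step could enter the interval from outside. -/
theorem gen_smul_basisOrZero (i : B) {x : W} (hx : cs.LeftWeakLE u x) :
    ZeroHecke.gen K M i • basisOrZero K cs u v x = basisOrZero K cs u v (cs.leftStep i x) := by
  by_cases h : x ∈ cs.leftInterval u v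
  · rw [basisOrZero_of_mem h, gen_smul_basis, genSMul_eq]
  · rw [basisOrZero_of_notMem h, smul_zero, basisOrZero_of_notMem]
    exact fun h' => h ⟨hx, (cs.leftWeakLE_leftStep i x).trans h'.2⟩

theorem prod_gen_smul_basisOrZero (ω : List B) {x : W} (hx : cs.LeftWeakLE u x) :
    (ω.map (ZeroHecke.gen K M)).prod • basisOrZero K cs u v x =
      basisOrZero K cs u v (ω.foldr cs.leftStep x) := by
  induction ω with
  | nil => simp
  | cons i ω ih =>
    rw [List.map_cons, List.prod_cons, mul_smul, ih, List.foldr_cons,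
      gen_smul_basisOrZero _ (hx.trans (cs.leftWeakLE_foldr_leftStep ω x))]

open scoped Classical in
/-- The coefficient at `y`, which is `0` for `y ∉ [u, v]_L`. -/
noncomputable def coeff (K : Type*) [Field K] (cs : CoxeterSystem M W) (u v y : W) :
    IntervalModule K cs u v →ₗ[K] K :=
  if h : y ∈ cs.leftInterval u v then (basis K cs u v).coord ⟨y, h⟩ else 0

theorem coeff_of_notMem {y : W} (h : y ∉ cs.leftInterval u v) (x : IntervalModule K cs u v) :
    coeff K cs u v y x = 0 := by
  rw [coeff, dif_neg h, LinearMap.zero_apply]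

theorem mem_of_coeff_ne_zero {y : W} {x : IntervalModule K cs u v}
    (h : coeff K cs u v y x ≠ 0) : y ∈ cs.leftInterval u v :=
  not_not.1 fun h' => h (coeff_of_notMem h' x)

theorem ext_coeff {x x' : IntervalModule K cs u v}
    (h : ∀ y ∈ cs.leftInterval u v, coeff K cs u v y x = coeff K cs u v y x') : x = x' := by
  apply (basis K cs u v).ext_elem
  intro y
  simpa [coeff] using h y y.2

open scoped Classical in
theorem coeff_basis (w : cs.leftInterval u v) (y : W) :
    coeff K cs u v y (basis K cs u v w) = if (w : W) = y then 1 else 0 := by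
  by_cases h : y ∈ cs.leftInterval u v
  · rw [coeff, dif_pos h, Module.Basis.coord_apply, Module.Basis.repr_self, Finsupp.single_apply]
    simp [Subtype.ext_iff]
  · rw [coeff_of_notMem h, if_neg]
    rintro rfl
    exact h w.2

open scoped Classical in
theorem coeff_basisOrZero (w y : W) : coeff K cs u v y (basisOrZero K cs u v w) =
    if w = y ∧ y ∈ cs.leftInterval u v then 1 else 0 := by
  by_cases h : w ∈ cs.leftInterval u v
  · rw [basisOrZero_of_mem h, coeff_basis]
    congr 1
    exact propext ⟨fun e => ⟨e, e ▸ h⟩, fun e => e.1⟩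
  · rw [basisOrZero_of_notMem h, map_zero, if_neg]
    rintro ⟨rfl, h'⟩
    exact h h'

open scoped Classical in
-- Only `y` and `s_i y` can be sent to `y`, and every element in the image of a step has `s_i` as a
-- left descent. The convention that coefficients vanish outside the interval covers the case where
-- `s_i y` is not in it.
theorem coeff_gen_smul (i : B) (x : IntervalModule K cs u v) (y : W) :
    coeff K cs u v y (ZeroHecke.gen K M i • x) =
      if cs.IsLeftDescent y i ∧ y ∈ cs.leftInterval u v then
        coeff K cs u v y x + coeff K cs u v (cs.simple i * y) x else 0 := by
  let f : IntervalModule K cs u v →ₗ[K] K :=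
    coeff K cs u v y ∘ₗ rep K cs u v (ZeroHecke.gen K M i)
  let g : IntervalModule K cs u v →ₗ[K] K :=
    if cs.IsLeftDescent y i ∧ y ∈ cs.leftInterval u v then
      coeff K cs u v y + coeff K cs u v (cs.simple i * y) else 0
  have hfg : f = g := by
    refine (basis K cs u v).ext fun w => ?_
    have e : f (basis K cs u v w) =
      coeff K cs u v y (ZeroHecke.gen K M i • basis K cs u v w) := rfl
    rw [e, gen_smul_basis, genSMul_eq, coeff_basisOrZero]
    have hdesc := cs.isLeftDescent_iff_not_isLeftDescent_mul (w := y) (i := i)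
    by_cases hy : y ∈ cs.leftInterval u v
    · by_cases hi : cs.IsLeftDescent y i
      · simp only [g, hi, hy, and_true, if_true, LinearMap.add_apply, coeff_basis]
        by_cases hw : cs.IsLeftDescent (w : W) i
        · have h1 : (w : W) ≠ cs.simple i * y := by
            intro h; rw [h] at hw; exact hdesc.1 hi hw
          simp [leftStep, hw, h1]
        · have h1 : (w : W) ≠ y := by rintro rfl; exact hw hi
          have h2 : cs.simple i * (w : W) = y ↔ (w : W) = cs.simple i * y := by
            constructor <;> intro h
            · rw [← h]; simp
            · rw [h]; simp
          simp [leftStep, hw, h1, h2]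
      · have h1 : cs.leftStep i w ≠ y := by
          rintro rfl
          apply hi
          by_cases hw : cs.IsLeftDescent (w : W) i
          · simp [leftStep, hw]
          · have := cs.isLeftDescent_iff_not_isLeftDescent_mul (w := cs.simple i * (w : W)) (i := i)
            rw [simple_mul_simple_cancel_left] at this
            simpa [leftStep, hw] using this.2 hw
        simp [g, hi, h1]
    · simp [g, hy]
  have := LinearMap.congr_fun hfg x
  have e : f x = coeff K cs u v y (ZeroHecke.gen K M i • x) := rfl
  rw [← e, this]
  simp only [g]
  split_ifs <;> simp

theorem left_mem (huv : cs.LeftWeakLE u v) : u ∈ cs.leftInterval u v := ⟨.refl u, huv⟩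

theorem right_mem (huv : cs.LeftWeakLE u v) : v ∈ cs.leftInterval u v := ⟨huv, .refl v⟩

theorem basisOrZero_ne_zero {x : W} (h : x ∈ cs.leftInterval u v) :
    basisOrZero K cs u v x ≠ 0 := by
  rw [basisOrZero_of_mem h]
  exact (basis K cs u v).ne_zero _

/-! ### The top: proper submodules when `u` is shortest -/

theorem coeff_simple_mul_left_end {i : B} (hi : cs.IsLeftDescent u i)
    (x : IntervalModule K cs u v) : coeff K cs u v (cs.simple i * u) x = 0 :=
  coeff_of_notMem (fun h => absurd h.1.length_le (not_le.2 hi)) x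

variable (K cs u v) in
/-- The submodule of `B(u, v)` spanned by all basis vectors other than `u`. -/
noncomputable def radical : Submodule (ZeroHecke K M) (IntervalModule K cs u v) where
  carrier := {x | coeff K cs u v u x = 0}
  add_mem' {x y} (hx : _ = 0) (hy : _ = 0) := by simp [hx, hy]
  zero_mem' := map_zero _
  smul_mem' a x hx := by
    refine ZeroHecke.smul_mem_of_gen_smul_mem (LinearMap.ker (coeff K cs u v u))
      (fun i x hx => ?_) a x hx
    rw [LinearMap.mem_ker] at hx ⊢
    rw [coeff_gen_smul]
    split_ifs with h
    · rw [hx, coeff_simple_mul_left_end h.1, zero_add]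
    · rfl

theorem radical_ne_top (huv : cs.LeftWeakLE u v) : radical K cs u v ≠ ⊤ := by
  intro h
  have h1 : basisOrZero K cs u v u ∈ radical K cs u v := h ▸ Submodule.mem_top
  have h2 : coeff K cs u v u (basisOrZero K cs u v u) = 0 := h1
  rw [coeff_basisOrZero, if_pos ⟨rfl, left_mem huv⟩] at h2
  exact one_ne_zero h2

theorem smul_mem_field (N : Submodule (ZeroHecke K M) (IntervalModule K cs u v)) (c : K)
    {x : IntervalModule K cs u v} (hx : x ∈ N) : c • x ∈ N :=
  (N.restrictScalars K).smul_mem c hx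

theorem mem_of_basisOrZero_mem (N : Submodule (ZeroHecke K M) (IntervalModule K cs u v))
    (x : IntervalModule K cs u v)
    (h : ∀ y, coeff K cs u v y x ≠ 0 → basisOrZero K cs u v y ∈ N) : x ∈ N := by
  classical
  rw [← (basis K cs u v).linearCombination_repr x, Finsupp.linearCombination_apply]
  refine N.sum_mem fun y hy => smul_mem_field N _ ?_
  rw [← basisOrZero_of_mem y.2]
  exact h y (by simpa [coeff] using hy)

theorem eq_top_of_basisOrZero_left_mem
    (N : Submodule (ZeroHecke K M) (IntervalModule K cs u v))
    (h : basisOrZero K cs u v u ∈ N) : N = ⊤ := by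
  rw [eq_top_iff]
  refine fun x _ => mem_of_basisOrZero_mem N x fun y hy => ?_
  obtain ⟨ω, rfl, -⟩ := (mem_of_coeff_ne_zero hy).1.exists_foldr
  rw [← prod_gen_smul_basisOrZero ω (.refl u)]
  exact N.smul_mem _ h

/-- The generator `u` is an eigenvector of all `π_i` modulo a maximal submodule. -/
theorem gen_smul_left_of_isCoatom [Finite W]
    {N : Submodule (ZeroHecke K M) (IntervalModule K cs u v)} (hN : IsCoatom N) (i : B) :
    ZeroHecke.gen K M i • basisOrZero K cs u v u - basisOrZero K cs u v u ∈ N ∨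
      ZeroHecke.gen K M i • basisOrZero K cs u v u ∈ N := by
  -- A longest basis element outside `N` is fixed by each generator or moved to a longer one, hence
  -- into `N`. So `N + K w` is a submodule, equal to everything by maximality, and `u` inherits the
  -- eigenvalues of `w` modulo `N`.
  obtain ⟨w, hw, hmax⟩ := Set.exists_max_image {w : W | basisOrZero K cs u v w ∉ N} cs.length
    (Set.toFinite _) ⟨u, fun h => hN.1 (eq_top_of_basisOrZero_left_mem N h)⟩
  have hwm : w ∈ cs.leftInterval u v := by
    by_contra h
    exact hw (by rw [basisOrZero_of_notMem h]; exact N.zero_mem)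
  have hgen : ∀ i, ZeroHecke.gen K M i • basisOrZero K cs u v w = basisOrZero K cs u v w ∨
      ZeroHecke.gen K M i • basisOrZero K cs u v w ∈ N := by
    intro i
    rw [gen_smul_basisOrZero i hwm.1]
    by_cases h : cs.IsLeftDescent w i
    · rw [cs.leftStep_eq_self_iff.2 h]; exact .inl rfl
    · right
      by_contra h'
      exact h (cs.isLeftDescent_of_length_leftStep_le (hmax _ h'))
  let P : Submodule K (IntervalModule K cs u v) :=
    N.restrictScalars K ⊔ K ∙ basisOrZero K cs u v w
  have hP : ∀ i, ∀ x ∈ P, ZeroHecke.gen K M i • x ∈ P := by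
    intro i x hx
    obtain ⟨n, hn, y, hy, rfl⟩ := Submodule.mem_sup.1 hx
    obtain ⟨c, rfl⟩ := Submodule.mem_span_singleton.1 hy
    rw [smul_add, smul_def _ (c • _), map_smul, ← smul_def]
    refine P.add_mem (Submodule.mem_sup_left (N.smul_mem _ hn)) (P.smul_mem c ?_)
    rcases hgen i with h | h
    · rw [h]; exact Submodule.mem_sup_right (Submodule.mem_span_singleton_self _)
    · exact Submodule.mem_sup_left h
  let P' : Submodule (ZeroHecke K M) (IntervalModule K cs u v) :=
    { P with smul_mem' := fun a x hx => ZeroHecke.smul_mem_of_gen_smul_mem P hP a x hx }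
  have hP' : P' = ⊤ := hN.2 _ <| lt_of_le_of_ne
    (fun x hx => (Submodule.mem_sup_left hx : x ∈ P)) fun h => hw <| by
      rw [h]
      exact (Submodule.mem_sup_right (Submodule.mem_span_singleton_self _) :
        basisOrZero K cs u v w ∈ P)
  have hu : basisOrZero K cs u v u ∈ P := (hP' ▸ Submodule.mem_top :
    basisOrZero K cs u v u ∈ P')
  obtain ⟨n, hn, y, hy, hsum⟩ := Submodule.mem_sup.1 hu
  obtain ⟨c, rfl⟩ := Submodule.mem_span_singleton.1 hy
  rw [← hsum, smul_add, smul_def _ (c • _), map_smul, ← smul_def]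
  rcases hgen i with h | h
  · left
    rw [h, add_sub_add_right_eq_sub]
    exact N.sub_mem (N.smul_mem _ hn) hn
  · exact .inr (N.add_mem (N.smul_mem _ hn) (smul_mem_field N c h))

theorem prod_gen_smul_sub_mem (N : Submodule (ZeroHecke K M) (IntervalModule K cs u v))
    {x : IntervalModule K cs u v} {ω : List B}
    (h : ∀ i ∈ ω, ZeroHecke.gen K M i • x - x ∈ N) :
    (ω.map (ZeroHecke.gen K M)).prod • x - x ∈ N := by
  induction ω with
  | nil => simp
  | cons i ω ih =>
    have := N.add_mem (N.smul_mem (ZeroHecke.gen K M i) (ih fun j hj => h j (by simp [hj])))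
      (h i (by simp))
    rwa [smul_sub, sub_add_sub_cancel, smul_smul, ← List.prod_cons, ← List.map_cons] at this

theorem le_radical [Finite W] (hu : cs.IsShortest u)
    (hd : ∀ i, cs.IsRightDescent v i → cs.IsRightDescent u i)
    (N : Submodule (ZeroHecke K M) (IntervalModule K cs u v)) (hN : N ≠ ⊤) :
    N ≤ radical K cs u v := by
  have : Module.Finite K (IntervalModule K cs u v) := .of_basis (basis K cs u v)
  have : Module.Finite (ZeroHecke K M) (IntervalModule K cs u v) :=
    .of_restrictScalars_finite K _ _
  obtain ⟨N', hN', hle⟩ := (eq_top_or_exists_le_coatom N).resolve_left hN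
  refine hle.trans ?_
  have huN : basisOrZero K cs u v u ∉ N' :=
    fun h => hN'.1 (eq_top_of_basisOrZero_left_mem N' h)
  obtain ⟨-, -, -, hl⟩ := hu.exists_word
  have hfix : ∀ i, cs.IsRightDescent u i →
      ZeroHecke.gen K M i • basisOrZero K cs u v u - basisOrZero K cs u v u ∈ N' := by
    intro i hi
    rw [gen_smul_basisOrZero i (.refl u), cs.leftStep_eq_self_iff.2 (hl i hi), sub_self]
    exact N'.zero_mem
  have hkill : ∀ t, ¬ cs.IsRightDescent u t →
      ZeroHecke.gen K M t • basisOrZero K cs u v u ∈ N' := by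
    intro t ht
    refine (gen_smul_left_of_isCoatom hN' t).resolve_left fun htN => ?_
    -- Acting by a word in the fixing generators preserves `u` modulo `N'`. Staying in the interval
    -- would make `t` a right descent of `u`; leaving it would put `u` into `N'`.
    obtain ⟨ω, hω, hωt⟩ := hu.exists_foldr_isRightDescent (J := {i | ZeroHecke.gen K M i •
      basisOrZero K cs u v u - basisOrZero K cs u v u ∈ N'}) hfix htN
    have h1 := prod_gen_smul_sub_mem N' hω
    rw [prod_gen_smul_basisOrZero ω (.refl u)] at h1
    by_cases hm : ω.foldr cs.leftStep u ∈ cs.leftInterval u v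
    · exact ht (hd t (hm.2.isRightDescent hωt))
    · rw [basisOrZero_of_notMem hm, zero_sub, N'.neg_mem_iff] at h1
      exact huN h1
  have hne : ∀ y ∈ cs.leftInterval u v, y ≠ u → basisOrZero K cs u v y ∈ N' := by
    intro y hy hyu
    obtain ⟨ω, rfl, hlen⟩ := hy.1.exists_foldr
    rcases List.eq_nil_or_concat ω with rfl | ⟨ω, i, rfl⟩
    · exact absurd rfl hyu
    · rw [← prod_gen_smul_basisOrZero _ (.refl u), List.concat_eq_append, List.map_append,
        List.prod_append, mul_smul, List.map_singleton, List.prod_singleton]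
      -- The letter applied first is not a right descent of `u`: otherwise it would be a left
      -- descent, its step would be wasted, and the remaining letters could not reach the required
      -- length.
      refine N'.smul_mem _ (hkill i fun hi => ?_)
      rw [List.concat_eq_append, List.foldr_append, List.foldr_cons, List.foldr_nil,
        cs.leftStep_eq_self_iff.2 (hl i hi)] at hlen
      have : ∀ ω : List B, cs.length (ω.foldr cs.leftStep u) ≤ cs.length u + ω.length := by
        intro ω
        induction ω with
        | nil => simp
        | cons j ω ih =>
          have h3 := cs.length_simple_mul (ω.foldr cs.leftStep u) j
          rw [List.foldr_cons, List.length_cons, leftStep]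
          split_ifs <;> omega
      have := this ω
      simp at hlen
      omega
  intro x hx
  by_contra hxu
  have hxu : coeff K cs u v u x ≠ 0 := hxu
  have hum := mem_of_coeff_ne_zero hxu
  have h1 : x - coeff K cs u v u x • basisOrZero K cs u v u ∈ N' := by
    refine mem_of_basisOrZero_mem N' _ fun y hy => hne y (mem_of_coeff_ne_zero hy) ?_
    rintro rfl
    rw [map_sub, map_smul, coeff_basisOrZero, if_pos ⟨rfl, hum⟩] at hy
    simp at hy
  have h2 := smul_mem_field N' (coeff K cs u v u x)⁻¹ ((N'.sub_mem_iff_right hx).1 h1)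
  rw [smul_smul, inv_mul_cancel₀ hxu, one_smul] at h2
  exact huN h2

/-! ### The socle: nonzero submodules when `v` is longest -/

/-- Every nonzero submodule contains a common eigenvector of all `π_i`. -/
theorem exists_eigenvector [Finite W]
    (N : Submodule (ZeroHecke K M) (IntervalModule K cs u v)) (hN : N ≠ ⊥) :
    ∃ x ∈ N, x ≠ 0 ∧ ∀ i, ZeroHecke.gen K M i • x = x ∨ ZeroHecke.gen K M i • x = 0 := by
  classical
  -- The set `U` is closed under left ascents, so the vectors supported on it are stable under the
  -- generators. The induction removes a shortest element `a` of `U` as long as `N` still has a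
  -- nonzero vector supported on the rest.
  have key : ∀ n : ℕ, ∀ U : Finset W, U.card = n →
      (∀ y ∈ U, ∀ i, ¬ cs.IsLeftDescent y i → cs.simple i * y ∈ U) →
      (∃ x ∈ N, x ≠ 0 ∧ ∀ y, coeff K cs u v y x ≠ 0 → y ∈ U) →
      ∃ x ∈ N, x ≠ 0 ∧ ∀ i, ZeroHecke.gen K M i • x = x ∨ ZeroHecke.gen K M i • x = 0 := by
    intro n
    induction n with
    | zero =>
      rintro U hU - ⟨x, -, hx, hxU⟩
      rw [Finset.card_eq_zero] at hU
      subst hU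
      exact absurd (ext_coeff fun y _ => by
        rw [map_zero]; by_contra h; simpa using hxU y h) hx
    | succ n ih =>
      rintro U hU hup ⟨x, hxN, hx, hxU⟩
      obtain ⟨a, haU, hmin⟩ := U.exists_min_image cs.length (Finset.card_pos.1 (by omega))
      by_cases hE : ∃ x ∈ N, x ≠ 0 ∧ ∀ y, coeff K cs u v y x ≠ 0 → y ∈ U.erase a
      · refine ih (U.erase a) (by rw [Finset.card_erase_of_mem haU]; omega) ?_ hE
        intro y hy i hi
        refine Finset.mem_erase.2 ⟨?_, hup y (Finset.mem_of_mem_erase hy) i hi⟩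
        rintro rfl
        have := hmin y (Finset.mem_of_mem_erase hy)
        have := cs.not_isLeftDescent_iff.1 hi
        omega
      · push Not at hE
        -- When `a` cannot be removed, vectors of `N` supported on `U` are determined by their
        -- coefficient at `a`. A generator keeps that coefficient or kills it, since nothing in `U`
        -- is shorter than `a`.
        have hzero : ∀ z ∈ N, (∀ y, coeff K cs u v y z ≠ 0 → y ∈ U) →
            coeff K cs u v a z = 0 → z = 0 := by
          intro z hz hzU hza
          by_contra hne
          obtain ⟨y, hy, hyU⟩ := hE z hz hne
          refine hyU (Finset.mem_erase.2 ⟨?_, hzU y hy⟩)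
          rintro rfl
          exact hy hza
        have hgU : ∀ i y, coeff K cs u v y (ZeroHecke.gen K M i • x) ≠ 0 → y ∈ U := by
          intro i y hy
          rw [coeff_gen_smul] at hy
          split_ifs at hy with h
          · by_cases h0 : coeff K cs u v y x = 0
            · rw [h0, zero_add] at hy
              have := hup _ (hxU _ hy) i (cs.isLeftDescent_iff_not_isLeftDescent_mul.1 h.1)
              rwa [simple_mul_simple_cancel_left] at this
            · exact hxU y h0
          · exact absurd rfl hy
        refine ⟨x, hxN, hx, fun i => ?_⟩
        have hgN : ZeroHecke.gen K M i • x ∈ N := N.smul_mem _ hxN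
        by_cases ha : cs.IsLeftDescent a i ∧ a ∈ cs.leftInterval u v
        · left
          rw [← sub_eq_zero]
          refine hzero _ (N.sub_mem hgN hxN) (fun y hy => ?_) ?_
          · by_contra hyU
            have h1 := not_not.1 (mt (hgU i y) hyU)
            have h2 := not_not.1 (mt (hxU y) hyU)
            rw [map_sub, h1, h2, sub_zero] at hy
            exact hy rfl
          · have : coeff K cs u v (cs.simple i * a) x = 0 := by
              by_contra h
              exact absurd (hmin _ (hxU _ h)) (not_le.2 ha.1)
            rw [map_sub, coeff_gen_smul, if_pos ha, this, add_zero, sub_self]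
        · right
          exact hzero _ hgN (hgU i) (by rw [coeff_gen_smul, if_neg ha])
  have := Fintype.ofFinite W
  obtain ⟨x, hx, hx0⟩ := N.ne_bot_iff.1 hN
  exact key _ Finset.univ rfl (by simp) ⟨x, hx, hx0, by simp⟩

theorem basisOrZero_right_mem [Finite W] (hv : cs.IsLongest v) (huv : cs.LeftWeakLE u v)
    (hd : ∀ i, cs.IsRightDescent v i → cs.IsRightDescent u i)
    (N : Submodule (ZeroHecke K M) (IntervalModule K cs u v)) (hN : N ≠ ⊥) :
    basisOrZero K cs u v v ∈ N := by
  obtain ⟨x, hxN, hx, heig⟩ := exists_eigenvector N hN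
  obtain ⟨w₀, h1, h2⟩ := cs.exists_length_mul_add
  have hu' := IsLongest.isShortest_mul h1 h2 hv
  have hfixed : ∀ i, ZeroHecke.gen K M i • x = x → ∀ y, coeff K cs u v y x ≠ 0 →
      cs.IsLeftDescent y i := by
    intro i hi y hy
    rw [← hi, coeff_gen_smul] at hy
    by_contra h
    exact hy (if_neg fun h' => h h'.1)
  have hkilled : ∀ i, ZeroHecke.gen K M i • x = 0 → ∀ y ∈ cs.leftInterval u v,
      cs.IsLeftDescent y i → coeff K cs u v y x + coeff K cs u v (cs.simple i * y) x = 0 := by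
    intro i hi y hy hyi
    have := coeff_gen_smul (K := K) i x y
    rwa [if_pos ⟨hyi, hy⟩, hi, map_zero, eq_comm] at this
  -- A fixed vector is supported on elements with left descent `i`, which `s_i y` lacks; so `π_i`
  -- kills `x`, and the coefficients at `y` and `s_i y` are opposite.
  have hdown : ∀ y ∈ cs.leftInterval u v, ∀ i, cs.IsLeftDescent y i →
      coeff K cs u v (cs.simple i * y) x ≠ 0 →
      ZeroHecke.gen K M i • x = 0 ∧ coeff K cs u v y x ≠ 0 := by
    intro y hy i hyi hc
    rcases heig i with h | h
    · exact absurd (hfixed i h _ hc) (cs.isLeftDescent_iff_not_isLeftDescent_mul.1 hyi)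
    · refine ⟨h, fun h0 => hc ?_⟩
      simpa [h0] using hkilled i h y hy hyi
  have hup : ∀ ω : List B, ∀ y, cs.LeftWeakLE u y → cs.length (cs.wordProd ω * y) =
      cs.length y + ω.length → cs.wordProd ω * y = v → coeff K cs u v y x ≠ 0 →
      coeff K cs u v v x ≠ 0 ∧ (y ≠ v → ∃ i, cs.IsLeftDescent v i ∧
        ZeroHecke.gen K M i • x = 0) := by
    intro ω
    induction ω using List.reverseRecOn with
    | nil =>
      rintro y - - rfl hc
      simp only [wordProd_nil, one_mul] at hc ⊢
      exact ⟨hc, fun h => absurd rfl h⟩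
    | append_singleton ω i ih =>
      intro y hy hlen hyv hc
      rw [wordProd_append, wordProd_singleton, mul_assoc] at hlen hyv
      rw [List.length_append, List.length_singleton] at hlen
      have a1 := cs.length_mul_le (cs.wordProd ω) (cs.simple i * y)
      have a2 := cs.length_wordProd_le ω
      have a3 := cs.length_simple_mul y i
      have hlen' : cs.length (cs.wordProd ω * (cs.simple i * y)) =
        cs.length (cs.simple i * y) + ω.length := by omega
      have hdesc : cs.IsLeftDescent (cs.simple i * y) i := by
        unfold IsLeftDescent
        rw [simple_mul_simple_cancel_left]
        omega
      have hy' : cs.LeftWeakLE u (cs.simple i * y) :=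
        hy.trans ⟨[i], by simp, by simp; omega⟩
      obtain ⟨hk, hc'⟩ := hdown _ ⟨hy', ω, hyv.symm, by rw [← hyv, hlen']⟩ i hdesc
        (by rwa [simple_mul_simple_cancel_left])
      obtain ⟨r1, r2⟩ := ih _ hy' hlen' hyv hc'
      refine ⟨r1, fun _ => ?_⟩
      by_cases he : cs.simple i * y = v
      · exact ⟨i, he ▸ hdesc, hk⟩
      · exact r2 he
  have hle : ∀ y, coeff K cs u v y x ≠ 0 → coeff K cs u v v x ≠ 0 ∧
      (y ≠ v → ∃ i, cs.IsLeftDescent v i ∧ ZeroHecke.gen K M i • x = 0) := by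
    intro y hy
    obtain ⟨hy1, ω, hω, hlen⟩ := mem_of_coeff_ne_zero hy
    exact hup ω y hy1 (by rw [← hω, hlen]) hω.symm hy
  have hcv : coeff K cs u v v x ≠ 0 := by
    by_contra h0
    exact hx (ext_coeff fun y _ => by rw [map_zero]; by_contra hy; exact (hle y hy).1 h0)
  have hnot : ∀ i, cs.IsLeftDescent v i → ZeroHecke.gen K M i • x ≠ 0 := by
    intro t ht htx
    obtain ⟨-, -, -, hl⟩ := hu'.exists_word
    -- Right descents of the shortest element `v * w₀` are left descents of it, hence left ascents
    -- of `v`. They cannot fix `x`, whose coefficient at `v` is nonzero, so they kill it.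
    obtain ⟨ω, hω, hωt⟩ := hu'.exists_foldr_isRightDescent
      (J := {i | ZeroHecke.gen K M i • x = 0}) (t := t) (fun i hi => by
        refine (heig i).resolve_left fun h => ?_
        exact (isLeftDescent_mul_longest h2).1 (hl i hi) (hfixed i h v hcv)) htx
    -- Upward steps from `v * w₀` are downward steps from `v`. Along killing generators these stay
    -- in the support of `x`, hence in the interval.
    have hpath : ∀ ω : List B, (∀ i ∈ ω, ZeroHecke.gen K M i • x = 0) →
        ∃ y, coeff K cs u v y x ≠ 0 ∧ ω.foldr cs.leftStep (v * w₀) = y * w₀ := by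
      intro ω
      induction ω with
      | nil => exact fun _ => ⟨v, hcv, rfl⟩
      | cons i ω ih =>
        intro hω
        obtain ⟨y, hy, he⟩ := ih fun j hj => hω j (by simp [hj])
        rw [List.foldr_cons, he]
        by_cases hyi : cs.IsLeftDescent y i
        · refine ⟨cs.simple i * y, fun h0 => hy ?_, ?_⟩
          · simpa [h0] using hkilled i (hω i (by simp)) y (mem_of_coeff_ne_zero hy) hyi
          · rw [leftStep, if_neg fun h => (isLeftDescent_mul_longest h2).1 h hyi, mul_assoc]
        · exact ⟨y, hy, if_pos ((isLeftDescent_mul_longest h2).2 hyi)⟩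
    obtain ⟨y, hy, he⟩ := hpath ω hω
    rw [he] at hωt
    have hym := mem_of_coeff_ne_zero hy
    -- Since `y` has the right descents of `v`, `t` is a right, hence left, descent of `v * w₀`, and
    -- so not a left descent of `v`.
    rw [isRightDescent_mul_longest_congr h1 h2 (w' := v) fun i =>
      ⟨hym.2.isRightDescent, fun h => hym.1.isRightDescent (hd i h)⟩] at hωt
    exact (isLeftDescent_mul_longest h2).1 (hl t hωt) ht
  have hxv : x = coeff K cs u v v x • basisOrZero K cs u v v := by
    refine ext_coeff fun y hy => ?_
    rw [map_smul, coeff_basisOrZero]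
    by_cases hyv : v = y
    · subst hyv; simp [hy]
    · rw [if_neg fun h => hyv h.1, smul_zero]
      by_contra hc
      obtain ⟨i, hi, hi'⟩ := (hle y hc).2 (Ne.symm hyv)
      exact hnot i hi hi'
  have := smul_mem_field N (coeff K cs u v v x)⁻¹ hxN
  rwa [hxv, smul_smul, map_smul, coeff_basisOrZero, if_pos ⟨rfl, right_mem huv⟩, smul_eq_mul,
    mul_one, inv_mul_cancel₀ hcv, one_smul] at this

end IntervalModule

/-! ### The main theorem -/

theorem mainTheorem5 {B W : Type*} [Group W] [Finite W] {M : CoxeterMatrix B}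
    (cs : CoxeterSystem M W) (K : Type*) [Field K] (I : Set B) :
    -- `P_I`, its nonzero submodules and its nonzero quotients are indecomposable
    (IsIndecomposable (ZeroHecke K M) (ProjIndec K cs I) ∧
      (∀ N : Submodule (ZeroHecke K M) (ProjIndec K cs I), N ≠ ⊥ →
        IsIndecomposable (ZeroHecke K M) N) ∧
      (∀ N : Submodule (ZeroHecke K M) (ProjIndec K cs I), N ≠ ⊤ →
        IsIndecomposable (ZeroHecke K M) (ProjIndec K cs I ⧸ N))) ∧
    ∀ w ∈ cs.descentClass I,
      -- `B(w, v_I)` and its nonzero submodules are indecomposable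
      (IsIndecomposable (ZeroHecke K M) (IntervalModule K cs w (cs.longest I)) ∧
        ∀ N : Submodule (ZeroHecke K M) (IntervalModule K cs w (cs.longest I)), N ≠ ⊥ →
          IsIndecomposable (ZeroHecke K M) N) ∧
      -- `B(u_I, w)` and its nonzero quotients are indecomposable
      (IsIndecomposable (ZeroHecke K M) (IntervalModule K cs (cs.shortest I) w) ∧
        ∀ N : Submodule (ZeroHecke K M) (IntervalModule K cs (cs.shortest I) w), N ≠ ⊤ →
          IsIndecomposable (ZeroHecke K M) (IntervalModule K cs (cs.shortest I) w ⧸ N)) := by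
  obtain ⟨hu, hv, huv⟩ := cs.isShortest_shortest_and_isLongest_longest I
  have lower : ∀ w, (∀ i, cs.IsRightDescent w i ↔ cs.IsRightDescent (cs.longest I) i) →
      IsIndecomposable (ZeroHecke K M) (IntervalModule K cs w (cs.longest I)) ∧
        ∀ N : Submodule (ZeroHecke K M) (IntervalModule K cs w (cs.longest I)), N ≠ ⊥ →
          IsIndecomposable (ZeroHecke K M) N := by
    intro w hw
    have hle := hv.leftWeakLE hw
    have hne := IntervalModule.basisOrZero_ne_zero (K := K) (IntervalModule.right_mem hle)
    have hmem := IntervalModule.basisOrZero_right_mem (K := K) hv hle fun i => (hw i).2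
    exact ⟨isIndecomposable_of_mem hne hmem, isIndecomposable_submodule hne hmem⟩
  have upper : ∀ w, (∀ i, cs.IsRightDescent w i ↔ cs.IsRightDescent (cs.longest I) i) →
      IsIndecomposable (ZeroHecke K M) (IntervalModule K cs (cs.shortest I) w) ∧
        ∀ N : Submodule (ZeroHecke K M) (IntervalModule K cs (cs.shortest I) w), N ≠ ⊤ →
          IsIndecomposable (ZeroHecke K M) (IntervalModule K cs (cs.shortest I) w ⧸ N) := by
    intro w hw
    have hd : ∀ i, cs.IsRightDescent (cs.shortest I) i ↔ cs.IsRightDescent w i :=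
      fun i => (huv i).trans (hw i).symm
    have hne := IntervalModule.radical_ne_top (K := K) (hu.leftWeakLE fun i => (hd i).1)
    have hle := IntervalModule.le_radical (K := K) hu fun i => (hd i).2
    exact ⟨isIndecomposable_of_le hne hle, isIndecomposable_quotient hne hle⟩
  -- `P_I` is the case `w = u_I` of the socle statement and the case `w = v_I` of the statement on
  -- quotients.
  obtain ⟨h1, h2⟩ := lower _ huv
  exact ⟨⟨h1, h2, (upper _ fun _ => Iff.rfl).2⟩, fun w hw =>
    ⟨lower w (cs.isRightDescent_iff_of_mem_descentClass hw),
      upper w (cs.isRightDescent_iff_of_mem_descentClass hw)⟩⟩
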